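/- **Lambek–Grishin algebras.** An LG-algebra is a poset $(G,\le)$ with six binary operations $\otimes,\backslash,/,\oplus,\oslash,\ominus$ ($\oslash$ and $\ominus$ are the right and left residuals of $\oplus$) such that for all $A,B,C$ $$B\le A\backslash C\iff A\otimes B\le C\iff A\le C/B,\qquad C\oslash B\le A\iff C\le A\oplus B\iff A\ominus C\le B$$ (so all operations are monotone or antitone in each coordinate). For terms $s,t$ over a set of atoms, $s\le t$ is *valid* if it holds in all LG-algebras under all valuations of the atoms. **The language of fD.LG.** Fix disjoint sets of positive atoms $p$ and negative atoms $n$. Formulas come in four sorts: pure positive $P$, shifted positive $\dot P$, pure negative $N$, shifted negative $\dot N$; a ring $\mathring{}$ means "pure or shifted": $$P::=p\mid\mathring P\otimes\mathring P\mid\mathring P\oslash\mathring N\mid\mathring N\ominus\mathring P,\quad N::=n\mid\mathring N\oplus\mathring N\mid\mathring P\backslash\mathring N\mid\mathring N/\mathring P,\quad \dot P::=\;\downarrow N,\quad \dot N::=\;\uparrow P.$$ Structures (positive $X,Y,Z$; negative $\Gamma,\Delta,\Sigma$) are $$X::=P\mid\check\downharpoonright\dot\Delta\mid\mathring X\hat\otimes\mathring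 X\mid\mathring X\hat\oslash\mathring\Delta\mid\mathring\Delta\hat\ominus\mathring X,\qquad \Delta::=N\mid\hat\upharpoonleft\dot X\mid\mathring\Delta\check\oplus\mathring\Delta\mid\mathring X\check\backslash\mathring\Delta\mid\mathring\Delta\check/\mathring X,$$ $$\dot X::=\dot P\mid\check\downarrow\Delta\mid\mathring X\check\oplus_\ell\mathring\Delta\mid\mathring\Delta\check\oplus_r\mathring X\mid\mathring\Delta\check\backslash_\ell\mathring\Delta\mid\mathring X\check\backslash_r\mathring X\mid\mathring X\check/_\ell\mathring X\mid\mathring\Delta\check/_r\mathring\Delta,$$ $$\dot\Delta::=\dot N\mid\hat\uparrow X\mid\mathring\Delta\hat\otimes_\ell\mathring X\mid\mathring X\hat\otimes_r\mathring\Delta\mid\mathring\Delta\hat\oslash_\ell\mathring\Delta\mid\mathring X\hat\oslash_r\mathring X\mid\mathring X\hat\ominus_\ell\mathring X\mid\mathring\Delta\hat\ominus_r\mathring\Delta.$$ A sequent is positive $\mathring X\vdash^+\mathring Y$, negative $\mathring\Gamma\vdash^-\mathring\Delta$, or neutral $\mathring X\vdash^0\mathring\Delta$; the levels (pure/shifted)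 of its two sides give four turnstiles of each kind, twelve in all. Below all structures and formulas may be pure or shifted unless the connectives force a sort or it is said otherwise. **The rules of fD.LG.** * Axioms: $p\vdash^+p$ and $n\vdash^-n$. * Cuts: from $X\vdash^+P$ and $P\vdash^+Y$ infer $X\vdash^+Y$; from $\Gamma\vdash^-N$ and $N\vdash^-\Delta$ infer $\Gamma\vdash^-\Delta$; from $X\vdash^+P$ and $P\vdash^0\Delta$ infer $X\vdash^0\Delta$; from $X\vdash^0N$ and $N\vdash^-\Delta$ infer $X\vdash^0\Delta$ ($P,N$ formulas). * Translation rules: from $A\,\hat\star\,B\vdash^0\Delta$ infer $A\star B\vdash^0\Delta$ for $\star\in\{\otimes,\oslash,\ominus\}$; from $X\vdash^0A\,\check\star\,B$ infer $X\vdash^0A\star B$ for $\star\in\{\oplus,\backslash,/\}$ ($A,B$ formulas); from $X\vdash^+\check\downarrow N$ infer $X\vdash^+\downarrow N$; from $\hat\uparrow P\vdash^-\Delta$ infer $\uparrow P\vdash^-\Delta$. * Tonicity rules ($P,Q,N,M$ formulas): from $X\vdash^+P$ and $Y\vdash^+Q$ infer $X\hat\otimes Y\vdash^+P\otimes Q$;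 from $X\vdash^+P$ and $N\vdash^-\Delta$ infer $X\hat\oslash\Delta\vdash^+P\oslash N$, $\ \Delta\hat\ominus X\vdash^+N\ominus P$, $\ P\backslash N\vdash^-X\check\backslash\Delta$ and $N/P\vdash^-\Delta\check/X$; from $N\vdash^-\Gamma$ and $M\vdash^-\Delta$ infer $N\oplus M\vdash^-\Gamma\check\oplus\Delta$; for pure $N,\Delta$, from $N\vdash^-\Delta$ infer $\downarrow N\vdash^+\check\downarrow\Delta$; for pure $X,P$, from $X\vdash^+P$ infer $\hat\uparrow X\vdash^-\uparrow P$. * Invertible rules (each $\Leftrightarrow$ may be used in both directions): $Y\vdash^0X\check\backslash\Delta\Leftrightarrow X\hat\otimes Y\vdash^0\Delta\Leftrightarrow X\vdash^0\Delta\check/Y$; $X\hat\oslash\Delta\vdash^0\Gamma\Leftrightarrow X\vdash^0\Gamma\check\oplus\Delta\Leftrightarrow\Gamma\hat\ominus X\vdash^0\Delta$; $Y\vdash^+X\check\backslash_rZ\Leftrightarrow X\hat\otimes Y\vdash^+Z\Leftrightarrow X\vdash^+Z\check/_\ell Y$; $\Sigma\hat\oslash_\ell\Delta\vdash^-\Gamma\Leftrightarrow\Sigma\vdash^-\Gamma\check\oplus\Delta\Leftrightarrow\Gamma\hat\ominus_r\Sigma\vdash^-\Delta$;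 $\Gamma\hat\ominus X\vdash^+Y\Leftrightarrow X\vdash^+\Gamma\check\oplus_rY\Leftrightarrow X\hat\oslash_rY\vdash^-\Gamma$; $X\hat\oslash\Delta\vdash^+Y\Leftrightarrow X\vdash^+Y\check\oplus_\ell\Delta\Leftrightarrow Y\hat\ominus_\ell X\vdash^-\Delta$; $\Gamma\vdash^-X\check\backslash\Delta\Leftrightarrow X\hat\otimes_r\Gamma\vdash^-\Delta\Leftrightarrow X\vdash^+\Delta\check/_r\Gamma$; $Y\vdash^+\Gamma\check\backslash_\ell\Delta\Leftrightarrow\Gamma\hat\otimes_\ell Y\vdash^-\Delta\Leftrightarrow\Gamma\vdash^-\Delta\check/Y$; $\hat\uparrow X\vdash^-\dot\Delta\Leftrightarrow X\vdash^+\check\downharpoonright\dot\Delta$; $\hat\uparrow X\vdash^-\Delta\Leftrightarrow X\vdash^+\check\downarrow\Delta$ ($X,\Delta$ pure); $\dot X\vdash^+\check\downarrow\Delta\Leftrightarrow\hat\upharpoonleft\dot X\vdash^-\Delta$ ($\Delta$ pure); $\mathring X\vdash^0\Delta\Leftrightarrow\mathring X\vdash^+\check\downarrow\Delta$ ($\Delta$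 pure); $X\vdash^0\mathring\Delta\Leftrightarrow\hat\uparrow X\vdash^-\mathring\Delta$ ($X$ pure). **Translation.** $\tau$ sends formulas to terms in the language of LG-algebras over the disjoint union of the positive and negative atoms: it keeps atoms and binary connectives and erases the shifts. It is extended to structures by reading a structural connective and its $\ell$- and $r$-variants as the corresponding connective and erasing the structural shifts and their adjoints. **Theorem (Completeness and Soundness w.r.t. LG-algebras).** 1. (Soundness, for all sequents.) If a sequent $\Psi\ t\ \Phi$ of structures, with any of the twelve turnstiles $t$, is derivable in fD.LG, then $\tau(\Psi)\le\tau(\Phi)$ is valid in all LG-algebras. 2. (Soundness and completeness.) Let $A\ t\ B$ be a sequent of formulas that is neutral, or positive or negative with at least one of $A,B$ shifted (that is, $t$ is any turnstile except the two focused ones, between two pure positive or two pure negative sides). Then $A\ t\ B$ is derivable in fD.LG if and only if $\tau(A)\le\tau(B)$ is valid in all LG-algebras. 3. (Every inequality is covered.) For all terms $a,b$ in the language of LG-algebras, $a\le b$ is valid in all LG-algebras if and only if there are a positive formula $\mathring P$ and a negative formula $\mathring N$ with $\tau(\mathring P)=a$, $\tau(\mathring N)=b$ and $\mathring P\vdash^0\mathring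 N$ derivable in fD.LG. -/

import Mathlib

universe u v

/-! ### Lambek-Grishin algebras -/

/-- A (basic) Lambek-Grishin algebra: a poset with six binary operations satisfying the residuation
laws. `ldiv A C` is `A \ C`, `rdiv C B` is `C / B`, `oslash C B` is `C ⊘ B` and `obslash A C` is
`A ⦸ C`. The operations are compatible with the order as a consequence of residuation, see
`LGAlgebra.compatible`. -/
class LGAlgebra (G : Type u) extends PartialOrder G where
  tensor : G → G → G
  ldiv : G → G → G
  rdiv : G → G → G
  oplus : G → G → G
  oslash : G → G → G
  obslash : G → G → G
  le_ldiv_iff : ∀ A B C : G, B ≤ ldiv A C ↔ tensor A B ≤ C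
  le_rdiv_iff : ∀ A B C : G, A ≤ rdiv C B ↔ tensor A B ≤ C
  oslash_le_iff : ∀ A B C : G, oslash C B ≤ A ↔ C ≤ oplus A B
  obslash_le_iff : ∀ A B C : G, obslash A C ≤ B ↔ C ≤ oplus A B

/-- Every operation of a Lambek-Grishin algebra is monotone or antitone in each coordinate. -/
theorem LGAlgebra.compatible {G : Type u} [LGAlgebra G] {a a' b b' : G} (ha : a ≤ a')
    (hb : b ≤ b') :
    LGAlgebra.tensor a b ≤ LGAlgebra.tensor a' b' ∧
    LGAlgebra.oplus a b ≤ LGAlgebra.oplus a' b' ∧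
    LGAlgebra.ldiv a' b ≤ LGAlgebra.ldiv a b' ∧
    LGAlgebra.rdiv a b' ≤ LGAlgebra.rdiv a' b ∧
    LGAlgebra.oslash a b' ≤ LGAlgebra.oslash a' b ∧
    LGAlgebra.obslash a' b ≤ LGAlgebra.obslash a b' := by
  have t : ∀ {a a' b b' : G}, a ≤ a' → b ≤ b' →
      LGAlgebra.tensor a b ≤ LGAlgebra.tensor a' b' := fun {a a' b b'} h k =>
    ((LGAlgebra.le_rdiv_iff _ _ _).1
      (h.trans ((LGAlgebra.le_rdiv_iff _ _ _).2 le_rfl))).trans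
      ((LGAlgebra.le_ldiv_iff _ _ _).1
        (k.trans ((LGAlgebra.le_ldiv_iff a' b' _).2 le_rfl)))
  have p : ∀ {a a' b b' : G}, a ≤ a' → b ≤ b' →
      LGAlgebra.oplus a b ≤ LGAlgebra.oplus a' b' := fun {a a' b b'} h k =>
    ((LGAlgebra.oslash_le_iff _ _ _).1
      (((LGAlgebra.oslash_le_iff _ _ _).2 le_rfl).trans h)).trans
      ((LGAlgebra.obslash_le_iff _ _ _).1
        (((LGAlgebra.obslash_le_iff a' b _).2 le_rfl).trans k))
  refine ⟨t ha hb, p ha hb, ?_, ?_, ?_, ?_⟩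
  · exact (LGAlgebra.le_ldiv_iff _ _ _).2
      ((t ha le_rfl).trans (((LGAlgebra.le_ldiv_iff _ _ _).1 le_rfl).trans hb))
  · exact (LGAlgebra.le_rdiv_iff _ _ _).2
      ((t le_rfl hb).trans (((LGAlgebra.le_rdiv_iff _ _ _).1 le_rfl).trans ha))
  · exact (LGAlgebra.oslash_le_iff _ _ _).2
      (ha.trans (((LGAlgebra.oslash_le_iff _ _ _).1 le_rfl).trans (p le_rfl hb)))
  · exact (LGAlgebra.obslash_le_iff _ _ _).2
      (hb.trans (((LGAlgebra.obslash_le_iff _ _ _).1 le_rfl).trans (p ha le_rfl)))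

namespace FDLG

/-- Formulas (terms) of the language of Lambek-Grishin algebras over a set of atoms. -/
inductive LGFm (At : Type u) : Type u
  | atom : At → LGFm At
  | tensor : LGFm At → LGFm At → LGFm At
  | ldiv : LGFm At → LGFm At → LGFm At
  | rdiv : LGFm At → LGFm At → LGFm At
  | oplus : LGFm At → LGFm At → LGFm At
  | oslash : LGFm At → LGFm At → LGFm At
  | obslash : LGFm At → LGFm At → LGFm At

/-- The value of a formula in a Lambek-Grishin algebra under a valuation of the atoms. -/
def LGFm.eval {At : Type u} {G : Type v} [LGAlgebra G] (val : At → G) : LGFm At → G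
  | .atom a => val a
  | .tensor A B => LGAlgebra.tensor (A.eval val) (B.eval val)
  | .ldiv A B => LGAlgebra.ldiv (A.eval val) (B.eval val)
  | .rdiv A B => LGAlgebra.rdiv (A.eval val) (B.eval val)
  | .oplus A B => LGAlgebra.oplus (A.eval val) (B.eval val)
  | .oslash A B => LGAlgebra.oslash (A.eval val) (B.eval val)
  | .obslash A B => LGAlgebra.obslash (A.eval val) (B.eval val)

/-- `A ≤ B` is valid in all Lambek-Grishin algebras (with carrier in `Type v`). -/
def LGValid {At : Type u} (A B : LGFm At) : Prop :=
  ∀ (G : Type v) [LGAlgebra G] (val : At → G), A.eval val ≤ B.eval val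

/-! ### The language of the focused display calculus -/

/-- The polarity of a formula or structure. -/
inductive Pol
  | pos
  | neg

/-- A formula or structure is either pure or shifted. -/
inductive Lvl
  | pure
  | shifted

/-- Formulas. `Fm AtP AtN a i` is the set of formulas of polarity `a` and level `i`; an argument at a
level `i` that is left free is a general (pure or shifted) formula of its polarity. -/
inductive Fm (AtP AtN : Type u) : Pol → Lvl → Type u
  | posAtom : AtP → Fm AtP AtN .pos .pure
  | tensor {i j : Lvl} : Fm AtP AtN .pos i → Fm AtP AtN .pos j → Fm AtP AtN .pos .pure
  | oslash {i j : Lvl} : Fm AtP AtN .pos i → Fm AtP AtN .neg j → Fm AtP AtN .pos .pure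
  | obslash {i j : Lvl} : Fm AtP AtN .neg i → Fm AtP AtN .pos j → Fm AtP AtN .pos .pure
  | negAtom : AtN → Fm AtP AtN .neg .pure
  | oplus {i j : Lvl} : Fm AtP AtN .neg i → Fm AtP AtN .neg j → Fm AtP AtN .neg .pure
  | ldiv {i j : Lvl} : Fm AtP AtN .pos i → Fm AtP AtN .neg j → Fm AtP AtN .neg .pure
  | rdiv {i j : Lvl} : Fm AtP AtN .neg i → Fm AtP AtN .pos j → Fm AtP AtN .neg .pure
  | down : Fm AtP AtN .neg .pure → Fm AtP AtN .pos .shifted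
  | up : Fm AtP AtN .pos .pure → Fm AtP AtN .neg .shifted

/-- Structures: formulas, the structural counterparts of the connectives and of the shifts `↓`, `↑`,
the structural `ℓ`- and `r`-variants of the connectives, and the structural adjoints
`downAdj = ⇂` (right adjoint of `↑`) and `upAdj = ↿` (left adjoint of `↓`) of the shifts. -/
inductive Str (AtP AtN : Type u) : Pol → Lvl → Type u
  | fm {a : Pol} {i : Lvl} : Fm AtP AtN a i → Str AtP AtN a i
  -- pure positive structures
  | downAdj : Str AtP AtN .neg .shifted → Str AtP AtN .pos .pure
  | tensor {i j : Lvl} : Str AtP AtN .pos i → Str AtP AtN .pos j → Str AtP AtN .pos .pure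
  | oslash {i j : Lvl} : Str AtP AtN .pos i → Str AtP AtN .neg j → Str AtP AtN .pos .pure
  | obslash {i j : Lvl} : Str AtP AtN .neg i → Str AtP AtN .pos j → Str AtP AtN .pos .pure
  -- pure negative structures
  | upAdj : Str AtP AtN .pos .shifted → Str AtP AtN .neg .pure
  | oplus {i j : Lvl} : Str AtP AtN .neg i → Str AtP AtN .neg j → Str AtP AtN .neg .pure
  | ldiv {i j : Lvl} : Str AtP AtN .pos i → Str AtP AtN .neg j → Str AtP AtN .neg .pure
  | rdiv {i j : Lvl} : Str AtP AtN .neg i → Str AtP AtN .pos j → Str AtP AtN .neg .pure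
  -- shifted positive structures
  | down : Str AtP AtN .neg .pure → Str AtP AtN .pos .shifted
  | oplusL {i j : Lvl} : Str AtP AtN .pos i → Str AtP AtN .neg j → Str AtP AtN .pos .shifted
  | oplusR {i j : Lvl} : Str AtP AtN .neg i → Str AtP AtN .pos j → Str AtP AtN .pos .shifted
  | ldivL {i j : Lvl} : Str AtP AtN .neg i → Str AtP AtN .neg j → Str AtP AtN .pos .shifted
  | ldivR {i j : Lvl} : Str AtP AtN .pos i → Str AtP AtN .pos j → Str AtP AtN .pos .shifted
  | rdivL {i j : Lvl} : Str AtP AtN .pos i → Str AtP AtN .pos j → Str AtP AtN .pos .shifted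
  | rdivR {i j : Lvl} : Str AtP AtN .neg i → Str AtP AtN .neg j → Str AtP AtN .pos .shifted
  -- shifted negative structures
  | up : Str AtP AtN .pos .pure → Str AtP AtN .neg .shifted
  | tensorL {i j : Lvl} : Str AtP AtN .neg i → Str AtP AtN .pos j → Str AtP AtN .neg .shifted
  | tensorR {i j : Lvl} : Str AtP AtN .pos i → Str AtP AtN .neg j → Str AtP AtN .neg .shifted
  | oslashL {i j : Lvl} : Str AtP AtN .neg i → Str AtP AtN .neg j → Str AtP AtN .neg .shifted
  | oslashR {i j : Lvl} : Str AtP AtN .pos i → Str AtP AtN .pos j → Str AtP AtN .neg .shifted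
  | obslashL {i j : Lvl} : Str AtP AtN .pos i → Str AtP AtN .pos j → Str AtP AtN .neg .shifted
  | obslashR {i j : Lvl} : Str AtP AtN .neg i → Str AtP AtN .neg j → Str AtP AtN .neg .shifted

/-- Well-formed sequents: positive, negative and neutral ones. Together with the levels `i`, `j` of
its two sides, each constructor accounts for four turnstiles, which makes twelve in all. -/
inductive Sequent (AtP AtN : Type u) : Type u
  | pos {i j : Lvl} : Str AtP AtN .pos i → Str AtP AtN .pos j → Sequent AtP AtN
  | neg {i j : Lvl} : Str AtP AtN .neg i → Str AtP AtN .neg j → Sequent AtP AtN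
  | ntr {i j : Lvl} : Str AtP AtN .pos i → Str AtP AtN .neg j → Sequent AtP AtN

infix:40 " ⊢ₚ " => Sequent.pos
infix:40 " ⊢ₙ " => Sequent.neg
infix:40 " ⊢₀ " => Sequent.ntr

/-! ### The rules -/

/-- The invertible (double line) rules: the display postulates and the two structural shift rules.
Each of them can be applied in both directions. -/
inductive DoubleLine {AtP AtN : Type u} : Sequent AtP AtN → Sequent AtP AtN → Prop
  -- neutral display postulates
  | tensor_ldiv {i j k : Lvl} (X : Str AtP AtN .pos i) (Y : Str AtP AtN .pos j)
      (D : Str AtP AtN .neg k) : DoubleLine (Y ⊢₀ .ldiv X D) (.tensor X Y ⊢₀ D)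
  | tensor_rdiv {i j k : Lvl} (X : Str AtP AtN .pos i) (Y : Str AtP AtN .pos j)
      (D : Str AtP AtN .neg k) : DoubleLine (.tensor X Y ⊢₀ D) (X ⊢₀ .rdiv D Y)
  | oslash_oplus {i j k : Lvl} (X : Str AtP AtN .pos i) (D : Str AtP AtN .neg j)
      (C : Str AtP AtN .neg k) : DoubleLine (.oslash X D ⊢₀ C) (X ⊢₀ .oplus C D)
  | obslash_oplus {i j k : Lvl} (X : Str AtP AtN .pos i) (D : Str AtP AtN .neg j)
      (C : Str AtP AtN .neg k) : DoubleLine (X ⊢₀ .oplus C D) (.obslash C X ⊢₀ D)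
  -- display postulates in positive and negative sequents
  | tensor_ldivR {i j k : Lvl} (X : Str AtP AtN .pos i) (Y : Str AtP AtN .pos j)
      (Z : Str AtP AtN .pos k) : DoubleLine (Y ⊢ₚ .ldivR X Z) (.tensor X Y ⊢ₚ Z)
  | tensor_rdivL {i j k : Lvl} (X : Str AtP AtN .pos i) (Y : Str AtP AtN .pos j)
      (Z : Str AtP AtN .pos k) : DoubleLine (.tensor X Y ⊢ₚ Z) (X ⊢ₚ .rdivL Z Y)
  | oslashL_oplus {i j k : Lvl} (S : Str AtP AtN .neg i) (D : Str AtP AtN .neg j)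
      (C : Str AtP AtN .neg k) : DoubleLine (.oslashL S D ⊢ₙ C) (S ⊢ₙ .oplus C D)
  | obslashR_oplus {i j k : Lvl} (S : Str AtP AtN .neg i) (D : Str AtP AtN .neg j)
      (C : Str AtP AtN .neg k) : DoubleLine (S ⊢ₙ .oplus C D) (.obslashR C S ⊢ₙ D)
  | obslash_oplusR {i j k : Lvl} (C : Str AtP AtN .neg i) (X : Str AtP AtN .pos j)
      (Y : Str AtP AtN .pos k) : DoubleLine (.obslash C X ⊢ₚ Y) (X ⊢ₚ .oplusR C Y)
  | oslashR_oplusR {i j k : Lvl} (C : Str AtP AtN .neg i) (X : Str AtP AtN .pos j)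
      (Y : Str AtP AtN .pos k) : DoubleLine (X ⊢ₚ .oplusR C Y) (.oslashR X Y ⊢ₙ C)
  | oslash_oplusL {i j k : Lvl} (X : Str AtP AtN .pos i) (D : Str AtP AtN .neg j)
      (Y : Str AtP AtN .pos k) : DoubleLine (.oslash X D ⊢ₚ Y) (X ⊢ₚ .oplusL Y D)
  | obslashL_oplusL {i j k : Lvl} (X : Str AtP AtN .pos i) (D : Str AtP AtN .neg j)
      (Y : Str AtP AtN .pos k) : DoubleLine (X ⊢ₚ .oplusL Y D) (.obslashL Y X ⊢ₙ D)
  | tensorR_ldiv {i j k : Lvl} (C : Str AtP AtN .neg i) (X : Str AtP AtN .pos j)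
      (D : Str AtP AtN .neg k) : DoubleLine (C ⊢ₙ .ldiv X D) (.tensorR X C ⊢ₙ D)
  | tensorR_rdivR {i j k : Lvl} (C : Str AtP AtN .neg i) (X : Str AtP AtN .pos j)
      (D : Str AtP AtN .neg k) : DoubleLine (.tensorR X C ⊢ₙ D) (X ⊢ₚ .rdivR D C)
  | tensorL_ldivL {i j k : Lvl} (Y : Str AtP AtN .pos i) (C : Str AtP AtN .neg j)
      (D : Str AtP AtN .neg k) : DoubleLine (Y ⊢ₚ .ldivL C D) (.tensorL C Y ⊢ₙ D)
  | tensorL_rdiv {i j k : Lvl} (Y : Str AtP AtN .pos i) (C : Str AtP AtN .neg j)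
      (D : Str AtP AtN .neg k) : DoubleLine (.tensorL C Y ⊢ₙ D) (C ⊢ₙ .rdiv D Y)
  -- display postulates for the shifts
  | up_downAdj (X : Str AtP AtN .pos .pure) (D : Str AtP AtN .neg .shifted) :
      DoubleLine (.up X ⊢ₙ D) (X ⊢ₚ .downAdj D)
  | up_down (X : Str AtP AtN .pos .pure) (D : Str AtP AtN .neg .pure) :
      DoubleLine (.up X ⊢ₙ D) (X ⊢ₚ .down D)
  | upAdj_down (X : Str AtP AtN .pos .shifted) (D : Str AtP AtN .neg .pure) :
      DoubleLine (X ⊢ₚ .down D) (.upAdj X ⊢ₙ D)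
  -- structural rules
  | down {i : Lvl} (X : Str AtP AtN .pos i) (D : Str AtP AtN .neg .pure) :
      DoubleLine (X ⊢₀ D) (X ⊢ₚ .down D)
  | up {i : Lvl} (X : Str AtP AtN .pos .pure) (D : Str AtP AtN .neg i) :
      DoubleLine (X ⊢₀ D) (.up X ⊢ₙ D)

/-- Derivability in the focused display calculus fD.LG. -/
inductive Derivable {AtP AtN : Type u} : Sequent AtP AtN → Prop
  -- axioms
  | posId (p : AtP) : Derivable (.fm (.posAtom p) ⊢ₚ .fm (.posAtom p))
  | negId (n : AtN) : Derivable (.fm (.negAtom n) ⊢ₙ .fm (.negAtom n))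
  -- cuts
  | pCut {i j k : Lvl} {X : Str AtP AtN .pos i} {P : Fm AtP AtN .pos j} {Y : Str AtP AtN .pos k} :
      Derivable (X ⊢ₚ .fm P) → Derivable (.fm P ⊢ₚ Y) → Derivable (X ⊢ₚ Y)
  | nCut {i j k : Lvl} {C : Str AtP AtN .neg i} {N : Fm AtP AtN .neg j} {D : Str AtP AtN .neg k} :
      Derivable (C ⊢ₙ .fm N) → Derivable (.fm N ⊢ₙ D) → Derivable (C ⊢ₙ D)
  | pnCut {i j k : Lvl} {X : Str AtP AtN .pos i} {P : Fm AtP AtN .pos j} {D : Str AtP AtN .neg k} :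
      Derivable (X ⊢ₚ .fm P) → Derivable (.fm P ⊢₀ D) → Derivable (X ⊢₀ D)
  | nnCut {i j k : Lvl} {X : Str AtP AtN .pos i} {N : Fm AtP AtN .neg j} {D : Str AtP AtN .neg k} :
      Derivable (X ⊢₀ .fm N) → Derivable (.fm N ⊢ₙ D) → Derivable (X ⊢₀ D)
  -- translation rules
  | tensorLeft {i j k : Lvl} {P : Fm AtP AtN .pos i} {Q : Fm AtP AtN .pos j}
      {D : Str AtP AtN .neg k} :
      Derivable (.tensor (.fm P) (.fm Q) ⊢₀ D) → Derivable (.fm (.tensor P Q) ⊢₀ D)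
  | oslashLeft {i j k : Lvl} {P : Fm AtP AtN .pos i} {N : Fm AtP AtN .neg j}
      {D : Str AtP AtN .neg k} :
      Derivable (.oslash (.fm P) (.fm N) ⊢₀ D) → Derivable (.fm (.oslash P N) ⊢₀ D)
  | obslashLeft {i j k : Lvl} {N : Fm AtP AtN .neg i} {P : Fm AtP AtN .pos j}
      {D : Str AtP AtN .neg k} :
      Derivable (.obslash (.fm N) (.fm P) ⊢₀ D) → Derivable (.fm (.obslash N P) ⊢₀ D)
  | oplusRight {i j k : Lvl} {X : Str AtP AtN .pos i} {N : Fm AtP AtN .neg j}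
      {M : Fm AtP AtN .neg k} :
      Derivable (X ⊢₀ .oplus (.fm N) (.fm M)) → Derivable (X ⊢₀ .fm (.oplus N M))
  | ldivRight {i j k : Lvl} {X : Str AtP AtN .pos i} {P : Fm AtP AtN .pos j}
      {N : Fm AtP AtN .neg k} :
      Derivable (X ⊢₀ .ldiv (.fm P) (.fm N)) → Derivable (X ⊢₀ .fm (.ldiv P N))
  | rdivRight {i j k : Lvl} {X : Str AtP AtN .pos i} {N : Fm AtP AtN .neg j}
      {P : Fm AtP AtN .pos k} :
      Derivable (X ⊢₀ .rdiv (.fm N) (.fm P)) → Derivable (X ⊢₀ .fm (.rdiv N P))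
  | downRight {i : Lvl} {X : Str AtP AtN .pos i} {N : Fm AtP AtN .neg .pure} :
      Derivable (X ⊢ₚ .down (.fm N)) → Derivable (X ⊢ₚ .fm (.down N))
  | upLeft {i : Lvl} {P : Fm AtP AtN .pos .pure} {D : Str AtP AtN .neg i} :
      Derivable (.up (.fm P) ⊢ₙ D) → Derivable (.fm (.up P) ⊢ₙ D)
  -- tonicity rules
  | tensorRight {i j k l : Lvl} {X : Str AtP AtN .pos i} {P : Fm AtP AtN .pos j}
      {Y : Str AtP AtN .pos k} {Q : Fm AtP AtN .pos l} :
      Derivable (X ⊢ₚ .fm P) → Derivable (Y ⊢ₚ .fm Q) →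
        Derivable (.tensor X Y ⊢ₚ .fm (.tensor P Q))
  | oslashRight {i j k l : Lvl} {X : Str AtP AtN .pos i} {P : Fm AtP AtN .pos j}
      {N : Fm AtP AtN .neg k} {D : Str AtP AtN .neg l} :
      Derivable (X ⊢ₚ .fm P) → Derivable (.fm N ⊢ₙ D) →
        Derivable (.oslash X D ⊢ₚ .fm (.oslash P N))
  | obslashRight {i j k l : Lvl} {N : Fm AtP AtN .neg i} {D : Str AtP AtN .neg j}
      {X : Str AtP AtN .pos k} {P : Fm AtP AtN .pos l} :
      Derivable (.fm N ⊢ₙ D) → Derivable (X ⊢ₚ .fm P) →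
        Derivable (.obslash D X ⊢ₚ .fm (.obslash N P))
  | oplusLeft {i j k l : Lvl} {N : Fm AtP AtN .neg i} {C : Str AtP AtN .neg j}
      {M : Fm AtP AtN .neg k} {D : Str AtP AtN .neg l} :
      Derivable (.fm N ⊢ₙ C) → Derivable (.fm M ⊢ₙ D) →
        Derivable (.fm (.oplus N M) ⊢ₙ .oplus C D)
  | ldivLeft {i j k l : Lvl} {X : Str AtP AtN .pos i} {P : Fm AtP AtN .pos j}
      {N : Fm AtP AtN .neg k} {D : Str AtP AtN .neg l} :
      Derivable (X ⊢ₚ .fm P) → Derivable (.fm N ⊢ₙ D) →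
        Derivable (.fm (.ldiv P N) ⊢ₙ .ldiv X D)
  | rdivLeft {i j k l : Lvl} {N : Fm AtP AtN .neg i} {D : Str AtP AtN .neg j}
      {X : Str AtP AtN .pos k} {P : Fm AtP AtN .pos l} :
      Derivable (.fm N ⊢ₙ D) → Derivable (X ⊢ₚ .fm P) →
        Derivable (.fm (.rdiv N P) ⊢ₙ .rdiv D X)
  | downLeft {N : Fm AtP AtN .neg .pure} {D : Str AtP AtN .neg .pure} :
      Derivable (.fm N ⊢ₙ D) → Derivable (.fm (.down N) ⊢ₚ .down D)
  | upRight {X : Str AtP AtN .pos .pure} {P : Fm AtP AtN .pos .pure} :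
      Derivable (X ⊢ₚ .fm P) → Derivable (.up X ⊢ₙ .fm (.up P))
  -- display postulates and structural rules, in both directions
  | dlDown {S T : Sequent AtP AtN} : DoubleLine S T → Derivable S → Derivable T
  | dlUp {S T : Sequent AtP AtN} : DoubleLine S T → Derivable T → Derivable S

/-! ### Erasure of the shifts -/

/-- The translation `τ` of formulas into the language of Lambek-Grishin algebras: it keeps the atoms
(positive and negative atoms being disjoint) and the binary connectives, and erases the shifts. -/
def Fm.tau {AtP AtN : Type u} : {a : Pol} → {i : Lvl} → Fm AtP AtN a i → LGFm (AtP ⊕ AtN)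
  | _, _, .posAtom p => .atom (.inl p)
  | _, _, .tensor A B => .tensor A.tau B.tau
  | _, _, .oslash A B => .oslash A.tau B.tau
  | _, _, .obslash A B => .obslash A.tau B.tau
  | _, _, .negAtom n => .atom (.inr n)
  | _, _, .oplus A B => .oplus A.tau B.tau
  | _, _, .ldiv A B => .ldiv A.tau B.tau
  | _, _, .rdiv A B => .rdiv A.tau B.tau
  | _, _, .down A => A.tau
  | _, _, .up A => A.tau

/-- The extension of `τ` to structures: structural connectives and their `ℓ`- and `r`-variants are
read as the corresponding connective, structural shifts and their adjoints are erased. -/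
def Str.tau {AtP AtN : Type u} : {a : Pol} → {i : Lvl} → Str AtP AtN a i → LGFm (AtP ⊕ AtN)
  | _, _, .fm A => A.tau
  | _, _, .downAdj D => D.tau
  | _, _, .upAdj X => X.tau
  | _, _, .down D => D.tau
  | _, _, .up X => X.tau
  | _, _, .tensor A B => .tensor A.tau B.tau
  | _, _, .tensorL A B => .tensor A.tau B.tau
  | _, _, .tensorR A B => .tensor A.tau B.tau
  | _, _, .oslash A B => .oslash A.tau B.tau
  | _, _, .oslashL A B => .oslash A.tau B.tau
  | _, _, .oslashR A B => .oslash A.tau B.tau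
  | _, _, .obslash A B => .obslash A.tau B.tau
  | _, _, .obslashL A B => .obslash A.tau B.tau
  | _, _, .obslashR A B => .obslash A.tau B.tau
  | _, _, .oplus A B => .oplus A.tau B.tau
  | _, _, .oplusL A B => .oplus A.tau B.tau
  | _, _, .oplusR A B => .oplus A.tau B.tau
  | _, _, .ldiv A B => .ldiv A.tau B.tau
  | _, _, .ldivL A B => .ldiv A.tau B.tau
  | _, _, .ldivR A B => .ldiv A.tau B.tau
  | _, _, .rdiv A B => .rdiv A.tau B.tau
  | _, _, .rdivL A B => .rdiv A.tau B.tau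
  | _, _, .rdivR A B => .rdiv A.tau B.tau

/-- The shift-erased translation of a sequent is valid in all Lambek-Grishin algebras. -/
def Sequent.TauValid {AtP AtN : Type u} : Sequent AtP AtN → Prop
  | .pos X Y => LGValid.{u, v} X.tau Y.tau
  | .neg C D => LGValid.{u, v} C.tau D.tau
  | .ntr X D => LGValid.{u, v} X.tau D.tau

end FDLG

open FDLG

/-!
Soundness is an induction on derivations: every rule becomes a residuation law, a monotonicity law
or transitivity once the shifts are erased.

For completeness, a term of the language of Lambek-Grishin algebras has exactly one positive and one
negative polarised form (`LGFm.posForm`, `LGFm.negForm`, unique by `Fm.forms_tau`): the position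
of every shift is forced. Put `a ≤ b` when the positive form of `a` entails the negative form of `b` in
a neutral sequent. This is the order of a Lindenbaum-Tarski algebra (`LGTerm.instLGAlgebra`), so
that an inequality which is valid in all algebras is derivable.

* Transitivity is a cut: of the two polarised forms of the middle term, one is the shift of the
  other, and a shift can be introduced on the side on which it is invertible.
* Reflexivity and residuation rest on a form of identity expansion. For a compound
  pure `P`, the sequent `P ⊢ₚ P` cannot be obtained in the usual way by tonicity followed by
  translation, since the translation rules for binary connectives act on neutral sequents only. But if
  `P.str` is `P` with its connectives turned into structural ones down to the shifts and atoms,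
  then `P.str ⊢ₚ P` is derivable by tonicity (`Fm.focused`), and inside a neutral sequent `P.str` can
  be folded back into `P` by display and translation (`Fm.foldable`). Dually for negative formulas.

A positive sequent with a shifted succedent, or a negative one with a shifted antecedent, is
equivalent to a neutral sequent. In the remaining unfocused cases the antecedent is a negative term
and the succedent a positive one. Such an inequality is never valid: it fails in the two-element
algebra in which `⊗`, `⊘`, `⦸` are constantly `⊥` and `⊕`, `\`, `/` are constantly `⊤`
(`not_lgValid_tau`).
-/

namespace FDLG

/-! ### Soundness -/

theorem DoubleLine.tauValid_iff {AtP AtN : Type u} {S T : Sequent AtP AtN} (h : DoubleLine S T) :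
    Sequent.TauValid.{u, v} S ↔ Sequent.TauValid.{u, v} T := by
  cases h <;> refine forall_congr' fun G => forall_congr' fun _ => forall_congr' fun val => ?_ <;>
    simp only [Str.tau, LGFm.eval, LGAlgebra.le_ldiv_iff, LGAlgebra.le_rdiv_iff,
      LGAlgebra.oslash_le_iff, LGAlgebra.obslash_le_iff]

theorem Derivable.tauValid {AtP AtN : Type u} {S : Sequent AtP AtN} (h : Derivable S) :
    Sequent.TauValid.{u, v} S := by
  induction h with
  | posId p => exact fun G _ val => le_rfl
  | negId n => exact fun G _ val => le_rfl
  | pCut _ _ h k => exact fun G _ val => (h G val).trans (k G val)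
  | nCut _ _ h k => exact fun G _ val => (h G val).trans (k G val)
  | pnCut _ _ h k => exact fun G _ val => (h G val).trans (k G val)
  | nnCut _ _ h k => exact fun G _ val => (h G val).trans (k G val)
  | tensorLeft _ h => exact h
  | oslashLeft _ h => exact h
  | obslashLeft _ h => exact h
  | oplusRight _ h => exact h
  | ldivRight _ h => exact h
  | rdivRight _ h => exact h
  | downRight _ h => exact h
  | upLeft _ h => exact h
  | tensorRight _ _ h k => exact fun G _ val => (LGAlgebra.compatible (h G val) (k G val)).1
  | oplusLeft _ _ h k => exact fun G _ val => (LGAlgebra.compatible (h G val) (k G val)).2.1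
  | ldivLeft _ _ h k => exact fun G _ val => (LGAlgebra.compatible (h G val) (k G val)).2.2.1
  | rdivLeft _ _ h k => exact fun G _ val => (LGAlgebra.compatible (h G val) (k G val)).2.2.2.1
  | oslashRight _ _ h k =>
    exact fun G _ val => (LGAlgebra.compatible (h G val) (k G val)).2.2.2.2.1
  | obslashRight _ _ h k =>
    exact fun G _ val => (LGAlgebra.compatible (h G val) (k G val)).2.2.2.2.2
  | downLeft _ h => exact h
  | upRight _ h => exact h
  | dlDown d _ h => exact d.tauValid_iff.1 h
  | dlUp d _ h => exact d.tauValid_iff.2 h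

/-! ### Identity expansion -/

/-- The structure obtained from a formula by turning its binary connectives into structural ones,
from the root down to the first shifts and atoms. -/
def Fm.str {AtP AtN : Type u} : {a : Pol} → {i : Lvl} → Fm AtP AtN a i → Str AtP AtN a i
  | _, _, .posAtom p => .fm (.posAtom p)
  | _, _, .tensor A B => .tensor A.str B.str
  | _, _, .oslash A B => .oslash A.str B.str
  | _, _, .obslash A B => .obslash A.str B.str
  | _, _, .negAtom n => .fm (.negAtom n)
  | _, _, .oplus A B => .oplus A.str B.str
  | _, _, .ldiv A B => .ldiv A.str B.str
  | _, _, .rdiv A B => .rdiv A.str B.str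
  | _, _, .down A => .fm (.down A)
  | _, _, .up A => .fm (.up A)

/-- In a neutral sequent, the structure `A.str` can be replaced by the formula `A`, on the left if
`A` is positive and on the right if it is negative. -/
def Fm.Foldable {AtP AtN : Type u} : {a : Pol} → {i : Lvl} → Fm AtP AtN a i → Prop
  | .pos, _, A => ∀ {k : Lvl} {D : Str AtP AtN .neg k},
      Derivable (A.str ⊢₀ D) → Derivable (.fm A ⊢₀ D)
  | .neg, _, A => ∀ {k : Lvl} {X : Str AtP AtN .pos k},
      Derivable (X ⊢₀ A.str) → Derivable (X ⊢₀ .fm A)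

open Derivable in
theorem Fm.foldable {AtP AtN : Type u} {a : Pol} {i : Lvl} (A : Fm AtP AtN a i) : A.Foldable := by
  induction A with
  | posAtom | negAtom | down | up => exact fun h => h
  | tensor A B hA hB =>
    exact fun h => tensorLeft (dlDown (.tensor_ldiv _ _ _) (hB (dlUp (.tensor_ldiv _ _ _)
      (dlUp (.tensor_rdiv _ _ _) (hA (dlDown (.tensor_rdiv _ _ _) h))))))
  | oslash A B hA hB =>
    exact fun h => oslashLeft (dlUp (.oslash_oplus _ _ _) (dlUp (.obslash_oplus _ _ _)
      (hB (dlDown (.obslash_oplus _ _ _) (hA (dlDown (.oslash_oplus _ _ _) h))))))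
  | obslash A B hA hB =>
    exact fun h => obslashLeft (dlDown (.obslash_oplus _ _ _) (dlDown (.oslash_oplus _ _ _)
      (hA (dlUp (.oslash_oplus _ _ _) (hB (dlUp (.obslash_oplus _ _ _) h))))))
  | oplus A B hA hB =>
    exact fun h => oplusRight (dlDown (.oslash_oplus _ _ _) (hA (dlUp (.oslash_oplus _ _ _)
      (dlUp (.obslash_oplus _ _ _) (hB (dlDown (.obslash_oplus _ _ _) h))))))
  | ldiv A B hA hB =>
    exact fun h => ldivRight (dlUp (.tensor_ldiv _ _ _) (dlUp (.tensor_rdiv _ _ _)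
      (hA (dlDown (.tensor_rdiv _ _ _) (hB (dlDown (.tensor_ldiv _ _ _) h))))))
  | rdiv A B hA hB =>
    exact fun h => rdivRight (dlDown (.tensor_rdiv _ _ _) (dlDown (.tensor_ldiv _ _ _)
      (hB (dlUp (.tensor_ldiv _ _ _) (hA (dlUp (.tensor_rdiv _ _ _) h))))))

theorem Fm.foldLeft {AtP AtN : Type u} {i k : Lvl} (P : Fm AtP AtN .pos i)
    {D : Str AtP AtN .neg k} (h : Derivable (P.str ⊢₀ D)) : Derivable (.fm P ⊢₀ D) :=
  P.foldable h

theorem Fm.foldRight {AtP AtN : Type u} {j k : Lvl} (N : Fm AtP AtN .neg j)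
    {X : Str AtP AtN .pos k} (h : Derivable (X ⊢₀ N.str)) : Derivable (X ⊢₀ .fm N) :=
  N.foldable h

/-- The focused sequent between `A` and `A.str` is derivable, with `A` in the focused position: on
the right if `A` is positive and on the left if it is negative. -/
def Fm.Focused {AtP AtN : Type u} : {a : Pol} → {i : Lvl} → Fm AtP AtN a i → Prop
  | .pos, _, A => Derivable (A.str ⊢ₚ .fm A)
  | .neg, _, A => Derivable (.fm A ⊢ₙ A.str)

open Derivable in
theorem Fm.focused {AtP AtN : Type u} {a : Pol} {i : Lvl} (A : Fm AtP AtN a i) : A.Focused := by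
  induction A with
  | posAtom p => exact posId p
  | negAtom n => exact negId n
  | tensor A B hA hB => exact tensorRight hA hB
  | oslash A B hA hB => exact oslashRight hA hB
  | obslash A B hA hB => exact obslashRight hA hB
  | oplus A B hA hB => exact oplusLeft hA hB
  | ldiv A B hA hB => exact ldivLeft hA hB
  | rdiv A B hA hB => exact rdivLeft hA hB
  -- A shift breaks the focus: passing through a neutral sequent, `A.str` is folded into `A`.
  | down A hA =>
    exact downRight (dlDown (.down _ _) (A.foldRight (dlUp (.down _ _) (downLeft hA))))
  | up A hA =>
    exact upLeft (dlDown (.up _ _) (A.foldLeft (dlUp (.up _ _) (upRight hA))))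

theorem Fm.focusedRight {AtP AtN : Type u} {i : Lvl} (P : Fm AtP AtN .pos i) :
    Derivable (P.str ⊢ₚ .fm P) :=
  P.focused

theorem Fm.focusedLeft {AtP AtN : Type u} {i : Lvl} (N : Fm AtP AtN .neg i) :
    Derivable (.fm N ⊢ₙ N.str) :=
  N.focused

/-! ### Invertibility of the translation rules -/

section Invertible

open Derivable

variable {AtP AtN : Type u} {i j k : Lvl}

theorem derivable_down_iff {X : Str AtP AtN .pos i} {N : Fm AtP AtN .neg .pure} :
    Derivable (X ⊢ₚ .fm (.down N)) ↔ Derivable (X ⊢₀ .fm N) :=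
  ⟨fun h => N.foldRight (dlUp (.down _ _) (pCut h (downLeft N.focusedLeft))),
    fun h => downRight (dlDown (.down _ _) h)⟩

theorem derivable_up_iff {P : Fm AtP AtN .pos .pure} {D : Str AtP AtN .neg i} :
    Derivable (.fm (.up P) ⊢ₙ D) ↔ Derivable (.fm P ⊢₀ D) :=
  ⟨fun h => P.foldLeft (dlUp (.up _ _) (nCut (upRight P.focusedRight) h)),
    fun h => upLeft (dlDown (.up _ _) h)⟩

theorem derivable_pos_refl (P : Fm AtP AtN .pos .pure) : Derivable (.fm P ⊢₀ .fm (.up P)) :=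
  derivable_up_iff.1 (Fm.up P).focusedLeft

theorem derivable_neg_refl (N : Fm AtP AtN .neg .pure) : Derivable (.fm (.down N) ⊢₀ .fm N) :=
  derivable_down_iff.1 (Fm.down N).focusedRight

theorem derivable_tensor_iff {P : Fm AtP AtN .pos i} {Q : Fm AtP AtN .pos j}
    {D : Str AtP AtN .neg k} :
    Derivable (.fm (.tensor P Q) ⊢₀ D) ↔ Derivable (.tensor (.fm P) (.fm Q) ⊢₀ D) := by
  refine ⟨fun h => ?_, tensorLeft⟩
  have h := pnCut (Fm.tensor P Q).focusedRight h
  have h := P.foldLeft (dlDown (.tensor_rdiv _ _ _) h)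
  have h := Q.foldLeft (dlUp (.tensor_ldiv _ _ _) (dlUp (.tensor_rdiv _ _ _) h))
  exact dlDown (.tensor_ldiv _ _ _) h

theorem derivable_oslash_iff {P : Fm AtP AtN .pos i} {N : Fm AtP AtN .neg j}
    {D : Str AtP AtN .neg k} :
    Derivable (.fm (.oslash P N) ⊢₀ D) ↔ Derivable (.oslash (.fm P) (.fm N) ⊢₀ D) := by
  refine ⟨fun h => ?_, oslashLeft⟩
  have h := pnCut (Fm.oslash P N).focusedRight h
  have h := P.foldLeft (dlDown (.oslash_oplus _ _ _) h)
  have h := N.foldRight (dlDown (.obslash_oplus _ _ _) h)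
  exact dlUp (.oslash_oplus _ _ _) (dlUp (.obslash_oplus _ _ _) h)

theorem derivable_obslash_iff {N : Fm AtP AtN .neg i} {P : Fm AtP AtN .pos j}
    {D : Str AtP AtN .neg k} :
    Derivable (.fm (.obslash N P) ⊢₀ D) ↔ Derivable (.obslash (.fm N) (.fm P) ⊢₀ D) := by
  refine ⟨fun h => ?_, obslashLeft⟩
  have h := pnCut (Fm.obslash N P).focusedRight h
  have h := P.foldLeft (dlUp (.obslash_oplus _ _ _) h)
  have h := N.foldRight (dlUp (.oslash_oplus _ _ _) h)
  exact dlDown (.obslash_oplus _ _ _) (dlDown (.oslash_oplus _ _ _) h)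

theorem derivable_oplus_iff {X : Str AtP AtN .pos i} {N : Fm AtP AtN .neg j}
    {M : Fm AtP AtN .neg k} :
    Derivable (X ⊢₀ .fm (.oplus N M)) ↔ Derivable (X ⊢₀ .oplus (.fm N) (.fm M)) := by
  refine ⟨fun h => ?_, oplusRight⟩
  have h := nnCut h (Fm.oplus N M).focusedLeft
  have h := N.foldRight (dlUp (.oslash_oplus _ _ _) h)
  have h := M.foldRight (dlDown (.obslash_oplus _ _ _) (dlDown (.oslash_oplus _ _ _) h))
  exact dlUp (.obslash_oplus _ _ _) h

theorem derivable_ldiv_iff {X : Str AtP AtN .pos i} {P : Fm AtP AtN .pos j}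
    {N : Fm AtP AtN .neg k} :
    Derivable (X ⊢₀ .fm (.ldiv P N)) ↔ Derivable (X ⊢₀ .ldiv (.fm P) (.fm N)) := by
  refine ⟨fun h => ?_, ldivRight⟩
  have h := nnCut h (Fm.ldiv P N).focusedLeft
  have h := N.foldRight (dlDown (.tensor_ldiv _ _ _) h)
  have h := P.foldLeft (dlDown (.tensor_rdiv _ _ _) h)
  exact dlUp (.tensor_ldiv _ _ _) (dlUp (.tensor_rdiv _ _ _) h)

theorem derivable_rdiv_iff {X : Str AtP AtN .pos i} {N : Fm AtP AtN .neg j}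
    {P : Fm AtP AtN .pos k} :
    Derivable (X ⊢₀ .fm (.rdiv N P)) ↔ Derivable (X ⊢₀ .rdiv (.fm N) (.fm P)) := by
  refine ⟨fun h => ?_, rdivRight⟩
  have h := nnCut h (Fm.rdiv N P).focusedLeft
  have h := N.foldRight (dlUp (.tensor_rdiv _ _ _) h)
  have h := P.foldLeft (dlUp (.tensor_ldiv _ _ _) h)
  exact dlDown (.tensor_rdiv _ _ _) (dlDown (.tensor_ldiv _ _ _) h)

end Invertible

/-! ### Polarised forms of terms -/

section Forms

variable {AtP AtN : Type u}

/-- A positive and a negative formula with the translation of a given formula: one of them is the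
formula itself, the other one is its shift if it is pure, and the body of its shift otherwise. -/
def Fm.forms : {a : Pol} → {i : Lvl} → Fm AtP AtN a i →
    (Σ i, Fm AtP AtN .pos i) × (Σ i, Fm AtP AtN .neg i)
  | .pos, .pure, P => (⟨_, P⟩, ⟨_, .up P⟩)
  | .neg, .pure, N => (⟨_, .down N⟩, ⟨_, N⟩)
  | .pos, .shifted, .down N => (⟨_, .down N⟩, ⟨_, N⟩)
  | .neg, .shifted, .up P => (⟨_, P⟩, ⟨_, .up P⟩)

/-- The positive and the negative formula whose translation is a given term. -/
def LGFm.forms : LGFm (AtP ⊕ AtN) → (Σ i, Fm AtP AtN .pos i) × (Σ i, Fm AtP AtN .neg i)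
  | .atom (.inl p) => (Fm.posAtom p).forms
  | .atom (.inr n) => (Fm.negAtom n).forms
  | .tensor a b => (Fm.tensor a.forms.1.2 b.forms.1.2).forms
  | .oslash a b => (Fm.oslash a.forms.1.2 b.forms.2.2).forms
  | .obslash a b => (Fm.obslash a.forms.2.2 b.forms.1.2).forms
  | .oplus a b => (Fm.oplus a.forms.2.2 b.forms.2.2).forms
  | .ldiv a b => (Fm.ldiv a.forms.1.2 b.forms.2.2).forms
  | .rdiv a b => (Fm.rdiv a.forms.2.2 b.forms.1.2).forms

abbrev LGFm.posForm (a : LGFm (AtP ⊕ AtN)) : Fm AtP AtN .pos a.forms.1.1 := a.forms.1.2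

abbrev LGFm.negForm (a : LGFm (AtP ⊕ AtN)) : Fm AtP AtN .neg a.forms.2.1 := a.forms.2.2

theorem LGFm.tau_forms (a : LGFm (AtP ⊕ AtN)) : a.posForm.tau = a ∧ a.negForm.tau = a := by
  induction a with
  | atom x => cases x <;> exact ⟨rfl, rfl⟩
  | _ a b ha hb => simp_all [LGFm.posForm, LGFm.negForm, LGFm.forms, Fm.forms, Fm.tau]

theorem Fm.forms_pos {i : Lvl} (P : Fm AtP AtN .pos i) : P.forms.1 = ⟨i, P⟩ := by
  cases P <;> rfl

theorem Fm.forms_neg {i : Lvl} (N : Fm AtP AtN .neg i) : N.forms.2 = ⟨i, N⟩ := by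
  cases N <;> rfl

/-- Polarised forms are unique: a formula is determined by its translation and its polarity. -/
theorem Fm.forms_tau {a : Pol} {i : Lvl} (A : Fm AtP AtN a i) : A.tau.forms = A.forms := by
  induction A with
  | posAtom | negAtom => rfl
  | down A h | up A h => exact h
  | _ A B hA hB =>
    rw [Fm.tau, LGFm.forms, hA, hB]
    first
    | rw [A.forms_pos, B.forms_pos]
    | rw [A.forms_pos, B.forms_neg]
    | rw [A.forms_neg, B.forms_pos]
    | rw [A.forms_neg, B.forms_neg]

end Forms

/-! ### The Lindenbaum-Tarski algebra -/

section Lindenbaum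

open Derivable

variable {AtP AtN : Type u}

/-- Derivability of an inequality between terms: its polarised form is a derivable neutral
sequent. -/
def LGFm.Entails (a b : LGFm (AtP ⊕ AtN)) : Prop :=
  Derivable (.fm a.posForm ⊢₀ .fm b.negForm)

/-- One of the two polarised forms of a term is the shift of the other. -/
theorem LGFm.forms_cases (a : LGFm (AtP ⊕ AtN)) :
    (∃ P : Fm AtP AtN .pos .pure, a.forms = (⟨_, P⟩, ⟨_, .up P⟩)) ∨
      ∃ N : Fm AtP AtN .neg .pure, a.forms = (⟨_, .down N⟩, ⟨_, N⟩) := by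
  rcases a with (_ | _) | _ | _ | _ | _ | _ | _
  all_goals first | exact .inl ⟨_, rfl⟩ | exact .inr ⟨_, rfl⟩

theorem LGFm.Entails.refl (a : LGFm (AtP ⊕ AtN)) : a.Entails a := by
  unfold LGFm.Entails LGFm.posForm LGFm.negForm
  rcases a.forms_cases with ⟨P, h⟩ | ⟨N, h⟩ <;> rw [h]
  · exact derivable_pos_refl P
  · exact derivable_neg_refl N

theorem LGFm.Entails.trans {a b c : LGFm (AtP ⊕ AtN)} (h : a.Entails b) (k : b.Entails c) :
    a.Entails c := by
  unfold LGFm.Entails LGFm.posForm LGFm.negForm at *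
  rcases b.forms_cases with ⟨P, hb⟩ | ⟨N, hb⟩ <;> rw [hb] at h k
  · exact nnCut h (derivable_up_iff.2 k)
  · exact pnCut (derivable_down_iff.2 h) k

theorem LGFm.entails_ldiv_iff (a b c : LGFm (AtP ⊕ AtN)) :
    b.Entails (.ldiv a c) ↔ (LGFm.tensor a b).Entails c :=
  derivable_ldiv_iff.trans (Iff.trans ⟨dlDown (.tensor_ldiv _ _ _), dlUp (.tensor_ldiv _ _ _)⟩
    derivable_tensor_iff.symm)

theorem LGFm.entails_rdiv_iff (a b c : LGFm (AtP ⊕ AtN)) :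
    a.Entails (.rdiv c b) ↔ (LGFm.tensor a b).Entails c :=
  derivable_rdiv_iff.trans (Iff.trans ⟨dlUp (.tensor_rdiv _ _ _), dlDown (.tensor_rdiv _ _ _)⟩
    derivable_tensor_iff.symm)

theorem LGFm.oslash_entails_iff (a b c : LGFm (AtP ⊕ AtN)) :
    (LGFm.oslash c b).Entails a ↔ c.Entails (.oplus a b) :=
  derivable_oslash_iff.trans (Iff.trans ⟨dlDown (.oslash_oplus _ _ _), dlUp (.oslash_oplus _ _ _)⟩
    derivable_oplus_iff.symm)

theorem LGFm.obslash_entails_iff (a b c : LGFm (AtP ⊕ AtN)) :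
    (LGFm.obslash a c).Entails b ↔ c.Entails (.oplus a b) :=
  derivable_obslash_iff.trans (Iff.trans ⟨dlUp (.obslash_oplus _ _ _),
    dlDown (.obslash_oplus _ _ _)⟩ derivable_oplus_iff.symm)

/-- Terms preordered by derivability. -/
instance LGFm.instPreorder : Preorder (LGFm (AtP ⊕ AtN)) where
  le := LGFm.Entails
  le_refl := LGFm.Entails.refl
  le_trans _ _ _ := LGFm.Entails.trans

theorem LGFm.tensor_mono {a a' b b' : LGFm (AtP ⊕ AtN)} (ha : a ≤ a') (hb : b ≤ b') :
    LGFm.tensor a b ≤ LGFm.tensor a' b' :=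
  ((entails_rdiv_iff _ _ _).1 (ha.trans ((entails_rdiv_iff _ _ _).2 (.refl _)))).trans
    ((entails_ldiv_iff _ _ _).1 (hb.trans ((entails_ldiv_iff _ _ _).2 (.refl _))))

theorem LGFm.oplus_mono {a a' b b' : LGFm (AtP ⊕ AtN)} (ha : a ≤ a') (hb : b ≤ b') :
    LGFm.oplus a b ≤ LGFm.oplus a' b' :=
  ((oslash_entails_iff _ _ _).1 (((oslash_entails_iff _ _ _).2 (.refl _)).trans ha)).trans
    ((obslash_entails_iff _ _ _).1 (((obslash_entails_iff _ _ _).2 (.refl _)).trans hb))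

theorem LGFm.ldiv_mono {a a' b b' : LGFm (AtP ⊕ AtN)} (ha : a ≤ a') (hb : b ≤ b') :
    LGFm.ldiv a' b ≤ LGFm.ldiv a b' :=
  (entails_ldiv_iff _ _ _).2 ((tensor_mono ha le_rfl).trans
    (((entails_ldiv_iff _ _ _).1 (.refl _)).trans hb))

theorem LGFm.rdiv_mono {a a' b b' : LGFm (AtP ⊕ AtN)} (ha : a ≤ a') (hb : b ≤ b') :
    LGFm.rdiv a b' ≤ LGFm.rdiv a' b :=
  (entails_rdiv_iff _ _ _).2 ((tensor_mono le_rfl hb).trans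
    (((entails_rdiv_iff _ _ _).1 (.refl _)).trans ha))

theorem LGFm.oslash_mono {a a' b b' : LGFm (AtP ⊕ AtN)} (ha : a ≤ a') (hb : b ≤ b') :
    LGFm.oslash a b' ≤ LGFm.oslash a' b :=
  (oslash_entails_iff _ _ _).2 (ha.trans
    (((oslash_entails_iff _ _ _).1 (.refl _)).trans (oplus_mono le_rfl hb)))

theorem LGFm.obslash_mono {a a' b b' : LGFm (AtP ⊕ AtN)} (ha : a ≤ a') (hb : b ≤ b') :
    LGFm.obslash a' b ≤ LGFm.obslash a b' :=
  (obslash_entails_iff _ _ _).2 (hb.trans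
    (((obslash_entails_iff _ _ _).1 (.refl _)).trans (oplus_mono ha le_rfl)))

variable (AtP AtN) in
/-- The carrier of the Lindenbaum-Tarski algebra: terms up to interderivability. It is lifted to an
arbitrary larger universe, as validity refers to the algebras of a fixed universe. -/
abbrev LGTerm : Type (max u v) :=
  ULift.{v} (Antisymmetrization (LGFm (AtP ⊕ AtN)) (· ≤ ·))

/-- The class of a term in the Lindenbaum-Tarski algebra. -/
def LGTerm.mk (a : LGFm (AtP ⊕ AtN)) : LGTerm.{u, v} AtP AtN :=
  ⟨toAntisymmetrization (· ≤ ·) a⟩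

/-- An operation on terms that respects interderivability, as an operation on classes. -/
def LGTerm.map₂ (f : LGFm (AtP ⊕ AtN) → LGFm (AtP ⊕ AtN) → LGFm (AtP ⊕ AtN))
    (hf : ∀ {a a' b b'}, AntisymmRel (· ≤ ·) a a' → AntisymmRel (· ≤ ·) b b' → f a b ≤ f a' b')
    (x y : LGTerm.{u, v} AtP AtN) : LGTerm.{u, v} AtP AtN :=
  ⟨Quotient.map₂ f (fun _ _ (h : AntisymmRel (· ≤ ·) _ _) _ _ (k : AntisymmRel (· ≤ ·) _ _) =>
    ⟨hf h k, hf h.symm k.symm⟩) x.down y.down⟩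

instance LGTerm.instLGAlgebra : LGAlgebra (LGTerm.{u, v} AtP AtN) where
  tensor := LGTerm.map₂ LGFm.tensor fun h k => LGFm.tensor_mono h.1 k.1
  ldiv := LGTerm.map₂ LGFm.ldiv fun h k => LGFm.ldiv_mono h.2 k.1
  rdiv := LGTerm.map₂ LGFm.rdiv fun h k => LGFm.rdiv_mono h.1 k.2
  oplus := LGTerm.map₂ LGFm.oplus fun h k => LGFm.oplus_mono h.1 k.1
  oslash := LGTerm.map₂ LGFm.oslash fun h k => LGFm.oslash_mono h.1 k.2
  obslash := LGTerm.map₂ LGFm.obslash fun h k => LGFm.obslash_mono h.2 k.1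
  le_ldiv_iff := by
    rintro ⟨⟨a⟩⟩ ⟨⟨b⟩⟩ ⟨⟨c⟩⟩
    exact LGFm.entails_ldiv_iff a b c
  le_rdiv_iff := by
    rintro ⟨⟨a⟩⟩ ⟨⟨b⟩⟩ ⟨⟨c⟩⟩
    exact LGFm.entails_rdiv_iff a b c
  oslash_le_iff := by
    rintro ⟨⟨a⟩⟩ ⟨⟨b⟩⟩ ⟨⟨c⟩⟩
    exact LGFm.oslash_entails_iff a b c
  obslash_le_iff := by
    rintro ⟨⟨a⟩⟩ ⟨⟨b⟩⟩ ⟨⟨c⟩⟩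
    exact LGFm.obslash_entails_iff a b c

theorem LGTerm.eval_mk (a : LGFm (AtP ⊕ AtN)) :
    a.eval (fun x => LGTerm.mk.{u, v} (.atom x)) = LGTerm.mk a := by
  induction a with
  | atom x => rfl
  | _ a b ha hb => rw [LGFm.eval, ha, hb]; rfl

theorem LGValid.entails {a b : LGFm (AtP ⊕ AtN)} (h : LGValid.{u, max u v} a b) :
    a.Entails b := by
  have h := h (LGTerm.{u, v} AtP AtN) (fun x => LGTerm.mk (.atom x))
  rwa [LGTerm.eval_mk, LGTerm.eval_mk] at h

theorem LGValid.derivable {i j : Lvl} {A : Fm AtP AtN .pos i} {B : Fm AtP AtN .neg j}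
    (h : LGValid.{u, max u v} A.tau B.tau) : Derivable (.fm A ⊢₀ .fm B) := by
  have h := LGValid.entails.{u, v} h
  unfold LGFm.Entails LGFm.posForm LGFm.negForm at h
  rwa [A.forms_tau, B.forms_tau, A.forms_pos, B.forms_neg] at h

end Lindenbaum

/-! ### Invalid inequalities -/

/-- The two-element Lambek-Grishin algebra in which the positive operations are constantly `⊥` and
the negative ones constantly `⊤`. -/
abbrev constLGAlgebra : LGAlgebra (ULift.{v} Prop) where
  tensor _ _ := ⊥
  ldiv _ _ := ⊤
  rdiv _ _ := ⊤
  oplus _ _ := ⊤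
  oslash _ _ := ⊥
  obslash _ _ := ⊥
  le_ldiv_iff _ _ _ := iff_of_true le_top bot_le
  le_rdiv_iff _ _ _ := iff_of_true le_top bot_le
  oslash_le_iff _ _ _ := iff_of_true bot_le le_top
  obslash_le_iff _ _ _ := iff_of_true bot_le le_top

/-- No inequality of a negative term below a positive one is valid. -/
theorem not_lgValid_tau {AtP AtN : Type u} (N : Fm AtP AtN .neg .pure) (P : Fm AtP AtN .pos .pure) :
    ¬ LGValid.{u, v} N.tau P.tau := by
  intro h
  let := constLGAlgebra.{v}
  let val : AtP ⊕ AtN → ULift.{v} Prop := Sum.elim (fun _ => ⊥) (fun _ => ⊤)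
  have hN : N.tau.eval val = ⊤ := by cases N <;> rfl
  have hP : P.tau.eval val = ⊥ := by cases P <;> rfl
  have h := h (ULift.{v} Prop) val
  rw [hN, hP] at h
  exact h trivial

end FDLG

theorem mainTheorem3 (AtP AtN : Type u) :
    -- soundness, for all sequents of structures and all turnstiles
    (∀ S : Sequent AtP AtN, Derivable S → Sequent.TauValid.{u, v} S) ∧
    -- soundness and completeness for neutral sequents of formulas
    (∀ (i j : Lvl) (A : Fm AtP AtN .pos i) (B : Fm AtP AtN .neg j),
      Derivable (.fm A ⊢₀ .fm B) ↔ LGValid.{u, max u v} A.tau B.tau) ∧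
    -- soundness and completeness for positive sequents of formulas, one of which is shifted
    (∀ (i j : Lvl) (A : Fm AtP AtN .pos i) (B : Fm AtP AtN .pos j),
      ¬ (i = .pure ∧ j = .pure) →
      (Derivable (.fm A ⊢ₚ .fm B) ↔ LGValid.{u, max u v} A.tau B.tau)) ∧
    -- soundness and completeness for negative sequents of formulas, one of which is shifted
    (∀ (i j : Lvl) (A : Fm AtP AtN .neg i) (B : Fm AtP AtN .neg j),
      ¬ (i = .pure ∧ j = .pure) →
      (Derivable (.fm A ⊢ₙ .fm B) ↔ LGValid.{u, max u v} A.tau B.tau)) ∧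
    -- every valid inequality is the translation of a derivable neutral sequent, and conversely
    (∀ A B : LGFm (AtP ⊕ AtN), LGValid.{u, max u v} A B ↔
      ∃ (i j : Lvl) (P : Fm AtP AtN .pos i) (N : Fm AtP AtN .neg j),
        P.tau = A ∧ N.tau = B ∧ Derivable (.fm P ⊢₀ .fm N)) := by
  refine ⟨fun S h => h.tauValid, fun i j A B => ⟨fun h => h.tauValid, LGValid.derivable.{u, v}⟩,
    fun i j A B hij => ⟨fun h => h.tauValid, fun h => ?_⟩,
    fun i j A B hij => ⟨fun h => h.tauValid, fun h => ?_⟩, fun a b => ⟨fun h => ?_, ?_⟩⟩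
  · cases j with
    | shifted =>
      cases B with | down N => exact derivable_down_iff.2 (LGValid.derivable.{u, v} h)
    | pure =>
      cases i with
      | pure => exact absurd ⟨rfl, rfl⟩ hij
      -- A negative term below a positive one: not derivable, and not valid either.
      | shifted =>
        cases A with | down N => exact absurd h (not_lgValid_tau N B)
  · cases i with
    | shifted =>
      cases A with | up P => exact derivable_up_iff.2 (LGValid.derivable.{u, v} h)
    | pure =>
      cases j with
      | pure => exact absurd ⟨rfl, rfl⟩ hij
      | shifted =>
        cases B with | up P => exact absurd h (not_lgValid_tau A P)
  · exact ⟨_, _, a.posForm, b.negForm, a.tau_forms.1, b.tau_forms.2, LGValid.entails.{u, v} h⟩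
  · rintro ⟨i, j, P, N, rfl, rfl, h⟩
    exact h.tauValid
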